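/- Let $L$ be a frame (complete Heyting algebra) with least element $0$, greatest element $1$ and implication $\to$. For $L$-subsets $A,B\in L^X$ put $\mathrm{sub}(A,B)=\bigwedge_{x\in X}(A(x)\to B(x))$, and call $A$ nonempty if $\bigvee_{x\in X}A(x)=1$. **$L$-orders.** An $L$-ordered set is a set $P$ with $e:P\times P\to L$ such that $e(x,x)=1$, $e(x,y)\wedge e(y,z)\le e(x,z)$, and $e(x,y)\wedge e(y,x)=1$ implies $x=y$. An element $s$ is the supremum $\sqcup A$ of $A\in L^P$ if $e(s,y)=\bigwedge_{x}(A(x)\to e(x,y))$ for all $y\in P$. A nonempty $D\in L^P$ is directed if $D(x)\wedge D(y)\le\bigvee_z D(z)\wedge e(x,z)\wedge e(y,z)$ for all $x,y$. $P$ is an $L$-dcpo if every directed $L$-subset has a supremum. A map $f:P\to Q$ is Scott continuous if for every directed $D\in L^P$ having a supremum, $f(\sqcup D)$ is the supremum of $f^{\rightarrow}(D)$, where $f^{\rightarrow}(D)(y)=\bigvee_{f(x)=y}D(x)$. Put $\Downarrow x(y)=\bigwedge_D\big(e(x,\sqcup D)\to\bigvee_{d}D(d)\wedge e(y,d)\big)$,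 with $D$ ranging over the directed $L$-subsets having a supremum. The element $x$ is compact if $\Downarrow x(x)=1$. Let $k(x)(y)=e(y,x)$ if $y$ is compact and $k(x)(y)=0$ otherwise. An $L$-dcpo $P$ is algebraic if for every $x\in P$ the $L$-subset $k(x)$ is directed and $\sqcup k(x)=x$. **$L$-topologies.** An $L$-topology on $X$ is a family $\mathcal O(X)\subseteq L^X$ closed under binary meets and arbitrary joins and containing all constant maps. A map $f:X\to Y$ is continuous if $B\circ f\in\mathcal O(X)$ for all $B\in\mathcal O(Y)$. A family $\mathcal B\subseteq\mathcal O(X)$ is a base if every $A\in\mathcal O(X)$ has the form $\bigvee_j a_j\wedge B_j$ with $a_j\in L$ and $B_j\in\mathcal B$. A nonempty $A\in L^X$ is super-compact if $\mathrm{sub}(A,\bigvee_i V_i)=\bigvee_i\mathrm{sub}(A,V_i)$ for every family $(V_i)$ of open sets. $X$ is strong locally super-compact if it has a base consisting of super-compact open sets. A point of $\mathcal O(X)$ is a map $p:\mathcal O(X)\to L$ preserving binary meets and arbitrary joins and satisfying $p(\lambda_X)=\lambda$ for every constant map $\lambda_X$, $\lambda\in L$. $X$ is $L$-sober if $x\mapsto[x]$,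 $[x](A)=A(x)$, is a bijection from $X$ onto the set of points of $\mathcal O(X)$; an $L$-sober space is $T_0$, that is, its points are separated by the open sets. **The assignments.** For an $L$-ordered set $P$, let $\Sigma_L P$ be the set $P$ with the Scott $L$-topology, whose open sets are the $A\in L^P$ with $A(x)\wedge e(x,y)\le A(y)$ for all $x,y$ and $A(\sqcup D)=\bigvee_x A(x)\wedge D(x)$ for every directed $D$ having a supremum. For a $T_0$ $L$-topological space $X$, let $\Omega_L X$ be the set $X$ with the specialization $L$-order $e(x,y)=\bigwedge_{A\in\mathcal O(X)}(A(x)\to A(y))$. **Theorem.** Let $L\text{-}\mathbf{SLSCSob}$ be the category of strong locally super-compact $L$-sober spaces with continuous maps and $L\text{-}\mathbf{AlgDom}$ the category of algebraic $L$-dcpo's with Scott continuous maps. The assignments $P\mapsto\Sigma_L P$ and $X\mapsto\Omega_L X$ on objects, each leaving the underlying map of a morphism unchanged, are functors $\Sigma_L:L\text{-}\mathbf{AlgDom}\to L\text{-}\mathbf{SLSCSob}$ and $\Omega_L:L\text{-}\mathbf{SLSCSob}\to L\text{-}\mathbf{AlgDom}$, and $\Omega_L\circ\Sigma_L=\mathrm{id}$,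 $\Sigma_L\circ\Omega_L=\mathrm{id}$. In particular the two categories are isomorphic. -/

import Mathlib

open CategoryTheory

universe u v

namespace FrameDomain

/-! ### `L`-subsets -/

section LSubsets

variable {L : Type u} [Order.Frame L]

/-- The inclusion degree `sub(A, B) = ⋀ₓ A(x) → B(x)` of `L`-subsets. -/
def sub {X : Type v} (A B : X → L) : L := ⨅ x, A x ⇨ B x

/-- An `L`-subset is nonempty if `⋁ₓ A(x) = 1`. -/
def IsNonempty {X : Type v} (A : X → L) : Prop := ⨆ x, A x = ⊤

/-- Zadeh extension: `f^→(A)(y) = ⋁_{f(x) = y} A(x)`. -/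
def zadeh {X Y : Type v} (f : X → Y) (A : X → L) : Y → L :=
  fun y => ⨆ (x : X) (_ : f x = y), A x

end LSubsets

/-! ### `L`-ordered sets -/

/-- An `L`-order on `P`. -/
structure LOrder (L : Type u) [Order.Frame L] (P : Type v) where
  e : P → P → L
  refl : ∀ x, e x x = ⊤
  trans : ∀ x y z, e x y ⊓ e y z ≤ e x z
  antisymm : ∀ x y, e x y ⊓ e y x = ⊤ → x = y

namespace LOrder

variable {L : Type u} [Order.Frame L] {P : Type v} (E : LOrder L P)

/-- `↓x`, i.e. `y ↦ e(y, x)`. -/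
def down (x : P) : P → L := fun y => E.e y x

/-- `A` is an upper set. -/
def IsUpper (A : P → L) : Prop := ∀ x y, A x ⊓ E.e x y ≤ A y

/-- `x = ⊔ A`: for all `y`, `e(x, y) = sub(A, ↓y)`. -/
def IsSup (A : P → L) (x : P) : Prop := ∀ y, E.e x y = sub A (E.down y)

/-- `D` is a directed `L`-subset. -/
def Directed (D : P → L) : Prop :=
  IsNonempty D ∧ ∀ x y, D x ⊓ D y ≤ ⨆ z, D z ⊓ E.e x z ⊓ E.e y z

/-- `P` is an `L`-dcpo. -/
def IsDcpo : Prop := ∀ D : P → L, E.Directed D → ∃ x, E.IsSup D x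

/-- The way-below `L`-subset
`⇓x (y) = ⋀_D (e(x, ⊔D) → ⋁_d D(d) ∧ e(y, d))`, the meet being taken over the directed
`L`-subsets `D` that have a supremum (here called `s`). -/
def wayBelow (x : P) : P → L := fun y =>
  ⨅ (D : P → L) (s : P) (_ : E.Directed D ∧ E.IsSup D s),
    E.e x s ⇨ ⨆ d, D d ⊓ E.e y d

/-- Compact elements. -/
def IsCompactElt (x : P) : Prop := E.wayBelow x x = ⊤

open Classical in
/-- `k(x)(y) = e(y, x)` if `y` is compact, and `0` otherwise. -/
noncomputable def k (x : P) : P → L := fun y => if E.IsCompactElt y then E.e y x else ⊥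

/-- Algebraic `L`-dcpo's. -/
def IsAlgebraicDcpo : Prop :=
  E.IsDcpo ∧ ∀ x, E.Directed (E.k x) ∧ E.IsSup (E.k x) x

/-- Scott open `L`-subsets. -/
def IsScottOpen (A : P → L) : Prop :=
  E.IsUpper A ∧ ∀ (D : P → L) (s : P), E.Directed D → E.IsSup D s → A s = ⨆ x, A x ⊓ D x

theorem down_directed (x : P) : E.Directed (E.down x) := by
  refine ⟨top_le_iff.1 ?_, fun y z => ?_⟩
  · rw [← E.refl x]
    exact le_iSup (fun y => E.e y x) x
  · refine le_trans ?_ (le_iSup _ x)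
    simp [down, E.refl]

theorem down_isSup (x : P) : E.IsSup (E.down x) x := by
  intro y
  apply le_antisymm
  · refine le_iInf fun z => le_himp_iff.2 ?_
    rw [inf_comm]
    exact E.trans z x y
  · refine (iInf_le _ x).trans ?_
    simp [down, E.refl]

theorem le_of_isSup {A : P → L} {x : P} (h : E.IsSup A x) (y : P) : A y ≤ E.e y x := by
  have h1 : (⊤ : L) ≤ A y ⇨ E.e y x := by
    rw [← E.refl x, h x]
    exact iInf_le _ y
  simpa using h1

end LOrder

section Scott

variable {L : Type u} [Order.Frame L] {P Q R : Type v}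

/-- Scott continuous maps: `f(⊔D)` is the supremum of `f^→(D)` for every directed `D` that has
a supremum. -/
def ScottCont (E : LOrder L P) (F : LOrder L Q) (f : P → Q) : Prop :=
  ∀ (D : P → L) (s : P), E.Directed D → E.IsSup D s → F.IsSup (zadeh f D) (f s)

theorem le_zadeh (f : P → Q) (A : P → L) (x : P) : A x ≤ zadeh f A (f x) :=
  le_iSup₂_of_le (f := fun (z : P) (_ : f z = f x) => A z) x rfl le_rfl

theorem zadeh_id (A : P → L) : zadeh (fun x => x) A = A := by
  funext y
  simp [zadeh]

theorem zadeh_comp (f : P → Q) (g : Q → R) (A : P → L) :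
    zadeh (fun x => g (f x)) A = zadeh g (zadeh f A) := by
  funext r
  apply le_antisymm
  · refine iSup₂_le fun x hx => ?_
    subst hx
    exact (le_zadeh f A x).trans (le_zadeh g _ _)
  · refine iSup₂_le fun y hy => iSup₂_le fun x hx => ?_
    subst hx
    subst hy
    exact le_zadeh (fun x => g (f x)) A x

theorem ScottCont.mono {E : LOrder L P} {F : LOrder L Q} {f : P → Q} (hf : ScottCont E F f)
    (x y : P) : E.e x y ≤ F.e (f x) (f y) :=
  (le_zadeh f (E.down y) x).trans
    (F.le_of_isSup (hf _ y (E.down_directed y) (E.down_isSup y)) (f x))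

theorem ScottCont.directed {E : LOrder L P} {F : LOrder L Q} {f : P → Q} (hf : ScottCont E F f)
    {D : P → L} (hD : E.Directed D) : F.Directed (zadeh f D) := by
  refine ⟨top_le_iff.1 ?_, fun a b => ?_⟩
  · rw [← hD.1]
    exact iSup_le fun x => (le_zadeh f D x).trans (le_iSup (zadeh f D) (f x))
  · simp only [zadeh, iSup_inf_eq, inf_iSup_eq]
    refine iSup₂_le fun x hx => iSup₂_le fun y hy => ?_
    subst hx
    subst hy
    refine (hD.2 _ _).trans (iSup_le fun z => ?_)
    refine le_iSup_of_le (f z) (le_iSup₂_of_le z rfl ?_)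
    exact inf_le_inf (inf_le_inf le_rfl (hf.mono _ _)) (hf.mono _ _)

theorem ScottCont.id (E : LOrder L P) : ScottCont E E (fun x => x) := by
  intro D s _ hs
  rw [zadeh_id]
  exact hs

theorem ScottCont.comp {E : LOrder L P} {F : LOrder L Q} {G : LOrder L R} {f : P → Q} {g : Q → R}
    (hf : ScottCont E F f) (hg : ScottCont F G g) : ScottCont E G (fun x => g (f x)) := by
  intro D s hD hs
  rw [zadeh_comp]
  exact hg _ _ (hf.directed hD) (hf D s hD hs)

end Scott

/-- An `L`-ordered set. -/
structure LPos (L : Type u) [Order.Frame L] where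
  carrier : Type v
  ord : LOrder L carrier

/-- A Scott continuous map between `L`-ordered sets. -/
@[ext]
structure LPos.Hom {L : Type u} [Order.Frame L] (P Q : LPos.{u, v} L) where
  toFun : P.carrier → Q.carrier
  cont : ScottCont P.ord Q.ord toFun

/-- The category of `L`-ordered sets and Scott continuous maps. -/
instance LPos.category (L : Type u) [Order.Frame L] : Category.{v} (LPos.{u, v} L) where
  Hom P Q := LPos.Hom P Q
  id P := ⟨fun x => x, ScottCont.id P.ord⟩
  comp f g := ⟨fun x => g.toFun (f.toFun x), f.cont.comp g.cont⟩

/-- The underlying-set functor. -/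
def LPos.forget (L : Type u) [Order.Frame L] : LPos.{u, v} L ⥤ Type v where
  obj P := P.carrier
  map f := TypeCat.ofHom (LPos.Hom.toFun f)

/-! ### `L`-topological spaces -/

/-- A (stratified) `L`-topology on `X`. -/
structure LTopology (L : Type u) [Order.Frame L] (X : Type v) where
  opens : Set (X → L)
  inf_mem : ∀ A B, A ∈ opens → B ∈ opens → A ⊓ B ∈ opens
  sSup_mem : ∀ S : Set (X → L), S ⊆ opens → sSup S ∈ opens
  const_mem : ∀ a : L, (fun _ => a) ∈ opens

namespace LTopology

variable {L : Type u} [Order.Frame L] {X : Type v} (T : LTopology L X)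

/-- `X` is `T₀`. -/
def IsT0 : Prop := ∀ x y, (∀ A ∈ T.opens, A x = A y) → x = y

/-- `B` is a base: it consists of open sets, and every open set is a join of a family
`a_j ∧ B_j` with `B_j` in the base and `a_j` in `L`. -/
def IsBase (B : Set (X → L)) : Prop :=
  B ⊆ T.opens ∧ ∀ A ∈ T.opens, ∃ J : Set ((X → L) × L),
    (∀ j ∈ J, j.1 ∈ B) ∧ A = ⨆ j ∈ J, fun x => j.2 ⊓ j.1 x

/-- Super-compact `L`-subsets. -/
def IsSuperCompact (A : X → L) : Prop :=
  IsNonempty A ∧ ∀ V : Set (X → L), V ⊆ T.opens → sub A (sSup V) = ⨆ U ∈ V, sub A U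

/-- Strong locally super-compact: there is a base of super-compact open sets. -/
def IsStrongLocallySuperCompact : Prop :=
  ∃ B : Set (X → L), T.IsBase B ∧ ∀ A ∈ B, T.IsSuperCompact A

/-- The points of the `L`-frame `O(X)`: the maps `O(X) → L` that preserve binary meets, arbitrary
joins and constants. -/
@[ext]
structure Point where
  toFun : T.opens → L
  map_inf : ∀ A B : T.opens,
    toFun ⟨A.1 ⊓ B.1, T.inf_mem _ _ A.2 B.2⟩ = toFun A ⊓ toFun B
  map_sSup : ∀ (S : Set (X → L)) (hS : S ⊆ T.opens),
    toFun ⟨sSup S, T.sSup_mem S hS⟩ = ⨆ (A : X → L) (hA : A ∈ S), toFun ⟨A, hS hA⟩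
  map_const : ∀ a : L, toFun ⟨fun _ => a, T.const_mem a⟩ = a

/-- The point `[x]`, given by `[x](A) = A(x)`. -/
def eta (x : X) : T.Point where
  toFun A := A.1 x
  map_inf _ _ := rfl
  map_sSup S hS := by simp [sSup_apply, iSup_subtype]
  map_const _ := rfl

/-- `L`-sober: `x ↦ [x]` is a bijection from `X` to the set of points of `O(X)`. -/
def IsSober : Prop := Function.Bijective T.eta

theorem IsSober.isT0 {T : LTopology L X} (h : T.IsSober) : T.IsT0 := by
  intro x y hxy
  apply h.1
  ext A
  exact hxy A.1 A.2

/-- The specialization `L`-order `e(x, y) = ⋀_{A ∈ O(X)} A(x) → A(y)` of a `T₀` space. -/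
def specialization (h : T.IsT0) : LOrder L X where
  e x y := ⨅ A ∈ T.opens, A x ⇨ A y
  refl x := by simp
  trans x y z := by
    refine le_iInf₂ fun A hA => ?_
    refine (inf_le_inf (iInf₂_le A hA) (iInf₂_le A hA)).trans ?_
    exact himp_triangle _ _ _
  antisymm x y hxy := by
    apply h
    intro A hA
    obtain ⟨h1, h2⟩ := inf_eq_top_iff.1 hxy
    apply le_antisymm
    · exact himp_eq_top_iff.1 (top_le_iff.1 (h1 ▸ iInf₂_le A hA))
    · exact himp_eq_top_iff.1 (top_le_iff.1 (h2 ▸ iInf₂_le A hA))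

end LTopology

/-- Continuity of a map between `L`-topological spaces. -/
def LCont {L : Type u} [Order.Frame L] {X Y : Type v} (T : LTopology L X) (U : LTopology L Y)
    (f : X → Y) : Prop :=
  ∀ B ∈ U.opens, (fun x => B (f x)) ∈ T.opens

/-- An `L`-topological space. -/
structure LTop (L : Type u) [Order.Frame L] where
  carrier : Type v
  top : LTopology L carrier

/-- A continuous map between `L`-topological spaces. -/
@[ext]
structure LTop.Hom {L : Type u} [Order.Frame L] (X Y : LTop.{u, v} L) where
  toFun : X.carrier → Y.carrier
  cont : LCont X.top Y.top toFun

/-- The category of `L`-topological spaces and continuous maps. -/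
instance LTop.category (L : Type u) [Order.Frame L] : Category.{v} (LTop.{u, v} L) where
  Hom X Y := LTop.Hom X Y
  id X := ⟨fun x => x, fun _ hB => hB⟩
  comp f g := ⟨fun x => g.toFun (f.toFun x), fun B hB => f.cont _ (g.cont B hB)⟩

/-- The underlying-set functor. -/
def LTop.forget (L : Type u) [Order.Frame L] : LTop.{u, v} L ⥤ Type v where
  obj X := X.carrier
  map f := TypeCat.ofHom (LTop.Hom.toFun f)

/-- The Scott `L`-topology: its open sets are the Scott open `L`-subsets. -/
def LOrder.scott {L : Type u} [Order.Frame L] {P : Type v} (E : LOrder L P) : LTopology L P where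
  opens := {A | E.IsScottOpen A}
  inf_mem A B hA hB := by
    refine ⟨fun x y => ?_, fun D s hD hs => ?_⟩
    · refine le_inf ?_ ?_
      · exact (inf_le_inf_right _ inf_le_left).trans (hA.1 x y)
      · exact (inf_le_inf_right _ inf_le_right).trans (hB.1 x y)
    · apply le_antisymm
      · rw [Pi.inf_apply, hA.2 D s hD hs, hB.2 D s hD hs]
        rw [iSup_inf_iSup]
        refine iSup_le fun ⟨x, y⟩ => ?_
        rw [inf_inf_inf_comm]
        refine (inf_le_inf_left _ (hD.2 x y)).trans ?_
        rw [inf_iSup_eq]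
        refine iSup_le fun z => le_iSup_of_le z (le_inf (le_inf ?_ ?_) ?_)
        · refine le_trans (le_inf ?_ ?_) (hA.1 x z)
          · exact inf_le_left.trans inf_le_left
          · exact inf_le_right.trans (inf_le_left.trans inf_le_right)
        · refine le_trans (le_inf ?_ ?_) (hB.1 y z)
          · exact inf_le_left.trans inf_le_right
          · exact inf_le_right.trans inf_le_right
        · exact inf_le_right.trans (inf_le_left.trans inf_le_left)
      · refine iSup_le fun x => le_inf ?_ ?_
        · rw [hA.2 D s hD hs]
          exact (inf_le_inf_right _ inf_le_left).trans (le_iSup (fun x => A x ⊓ D x) x)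
        · rw [hB.2 D s hD hs]
          exact (inf_le_inf_right _ inf_le_right).trans (le_iSup (fun x => B x ⊓ D x) x)
  sSup_mem S hS := by
    refine ⟨fun x y => ?_, fun D s hD hs => ?_⟩
    · simp only [sSup_apply, iSup_inf_eq]
      exact iSup_le fun A => le_iSup_of_le A ((hS A.2).1 x y)
    · simp only [sSup_apply, iSup_inf_eq]
      rw [iSup_comm]
      exact iSup_congr fun A => (hS A.2).2 D s hD hs
  const_mem a := by
    refine ⟨fun _ _ => inf_le_left, fun D s hD _ => ?_⟩
    have h : ⨆ x, D x = ⊤ := hD.1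
    rw [← inf_iSup_eq, h, inf_top_eq]

/-- The Scott space `Σ_L P`. -/
def LPos.scottSpace {L : Type u} [Order.Frame L] (P : LPos.{u, v} L) : LTop.{u, v} L :=
  ⟨P.carrier, P.ord.scott⟩

/-- The specialization `L`-ordered set `Ω_L X` of a `T₀` `L`-topological space. -/
def LTop.specSet {L : Type u} [Order.Frame L] (X : LTop.{u, v} L) (h : X.top.IsT0) :
    LPos.{u, v} L :=
  ⟨X.carrier, X.top.specialization h⟩

/-! ### The two categories -/

/-- Algebraic `L`-dcpo's, as a property of `L`-ordered sets. -/
def isAlgDom (L : Type u) [Order.Frame L] : ObjectProperty (LPos.{u, v} L) :=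
  fun P => P.ord.IsAlgebraicDcpo

/-- Strong locally super-compact `L`-sober spaces, as a property of `L`-topological spaces. -/
def isSLSCSob (L : Type u) [Order.Frame L] : ObjectProperty (LTop.{u, v} L) :=
  fun X => X.top.IsStrongLocallySuperCompact ∧ X.top.IsSober

/-- The category of algebraic `L`-dcpo's and Scott continuous maps. -/
abbrev AlgDom (L : Type u) [Order.Frame L] := (isAlgDom.{u, v} L).FullSubcategory

/-- The category of strong locally super-compact `L`-sober spaces and continuous maps. -/
abbrev SLSCSob (L : Type u) [Order.Frame L] := (isSLSCSob.{u, v} L).FullSubcategory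

end FrameDomain

namespace FrameDomain

/-! ### Compact elements and Scott open `L`-subsets -/

section Order

variable {L : Type u} [Order.Frame L] {P Q : Type v}

/-! Both directions turn on principal upper sets `e c`. An element `c` of an `L`-ordered set is
compact exactly when `e c` is Scott open, and `sub (e c) A = A c` for every upper `A`.

From orders to spaces: algebraicity, evaluated on a Scott open `A`, expands it as `A x = ⨆ A c ⊓ e c
x` over compact `c`. So the sets `e c` form a base, and they are super-compact because `sub (e c)`
is evaluation at `c`. A point `p` is determined by its values `p (e c)`; these form a directed
`L`-subset, and its supremum represents `p`. The same sets `e c` recover the order as specialization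
order.

From spaces to orders: sobriety is used twice. A directed `D` gives the point `A ↦ ⨆ A x ⊓ D x`, and
the element representing it is the supremum of `D`; hence directed suprema exist and open sets are
Scott open. A super-compact open `A` gives the point `V ↦ sub A V`, and if `c` represents it then `A
= e c`. The base thus consists of open principal upper sets, so every `x` is the directed supremum
of the `c` below it with `e c` open. Scott open sets are therefore open, the compact elements are
exactly these `c`, and the order is an algebraic `L`-dcpo. -/

@[ext]
theorem LOrder.ext {E F : LOrder L P} (h : ∀ x y, E.e x y = F.e x y) : E = F := by
  cases E
  cases F
  congr
  funext x y
  exact h x y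

@[ext]
theorem LTopology.ext {T U : LTopology L P} (h : ∀ A, A ∈ T.opens ↔ A ∈ U.opens) : T = U := by
  cases T
  cases U
  congr
  exact Set.ext h

namespace LOrder

variable (E : LOrder L P)

/-- Suprema are unique. -/
theorem IsSup.unique {E : LOrder L P} {A : P → L} {s t : P} (hs : E.IsSup A s)
    (ht : E.IsSup A t) : s = t := by
  apply E.antisymm
  rw [hs t, ← ht t, ht s, ← hs s, E.refl, E.refl, inf_top_eq]

/-- The part of `↓x` that lies in `K`. -/
def downIn (K : Set P) (x : P) : P → L := fun y => ⨆ _ : y ∈ K, E.e y x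

/-- With `K` left free, the same `L`-subset serves for a sober space, where `K` is the set of `c`
with `e c` open, before these are known to be the compact elements. -/
theorem k_eq_downIn (x : P) : E.k x = E.downIn {c | E.IsCompactElt c} x := by
  classical
  funext y
  by_cases h : E.IsCompactElt y <;> simp [k, downIn, h]

theorem e_inf_eq_of_isCompactElt {c : P} (hc : E.IsCompactElt c) {D : P → L} {s : P}
    (hD : E.Directed D) (hs : E.IsSup D s) : E.e c s = ⨆ x, E.e c x ⊓ D x := by
  apply le_antisymm
  · have h : (⊤ : L) ≤ E.e c s ⇨ ⨆ d, D d ⊓ E.e c d := by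
      rw [← (show E.wayBelow c c = ⊤ from hc)]
      exact (iInf_le _ D).trans ((iInf_le _ s).trans (iInf_le _ ⟨hD, hs⟩))
    simpa [inf_comm] using h
  · exact iSup_le fun x => (inf_le_inf_left _ (E.le_of_isSup hs x)).trans (E.trans _ _ _)

theorem isCompactElt_of_isScottOpen {c : P} (hc : E.IsScottOpen (E.e c)) :
    E.IsCompactElt c := by
  refine top_le_iff.1 (le_iInf fun D => le_iInf fun s => le_iInf fun h => ?_)
  rw [hc.2 D s h.1 h.2]
  simp [inf_comm]

theorem isScottOpen_e {c : P} (hc : E.IsCompactElt c) : E.IsScottOpen (E.e c) :=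
  ⟨fun x y => E.trans c x y, fun _ _ hD hs => E.e_inf_eq_of_isCompactElt hc hD hs⟩

/-- A Yoneda lemma: the value at `c` itself gives one bound, upwardness of `A` the other. -/
theorem sub_e_eq {A : P → L} (hA : E.IsUpper A) (c : P) : sub (E.e c) A = A c := by
  apply le_antisymm
  · refine (iInf_le _ c).trans ?_
    simp [E.refl]
  · exact le_iInf fun x => le_himp_iff.2 (hA c x)

/-- In an algebraic `L`-dcpo, a Scott open set is a join of principal upper sets of compact
elements. -/
theorem IsScottOpen.eq_iSup {E : LOrder L P} (hE : E.IsAlgebraicDcpo) {A : P → L}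
    (hA : E.IsScottOpen A) (x : P) :
    A x = ⨆ c : {c // E.IsCompactElt c}, A c ⊓ E.e c x := by
  rw [hA.2 _ x (hE.2 x).1 (hE.2 x).2, k_eq_downIn]
  simp [downIn, inf_iSup_eq, iSup_subtype]

/-- The specialization order of the Scott topology of an algebraic `L`-dcpo. -/
theorem iInf_scott_himp (hE : E.IsAlgebraicDcpo) (x y : P) :
    ⨅ A ∈ E.scott.opens, A x ⇨ A y = E.e x y := by
  apply le_antisymm
  · rw [(hE.2 x).2 y, k_eq_downIn]
    refine le_iInf fun c => le_himp_iff.2 ?_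
    simp only [downIn, inf_iSup_eq]
    refine iSup_le fun hc => ?_
    exact le_himp_iff.1 (iInf₂_le (E.e c) (E.isScottOpen_e hc))
  · refine le_iInf₂ fun A hA => le_himp_iff.2 ?_
    rw [inf_comm]
    exact hA.1 x y

end LOrder

/-- Change of variables along `f`; it turns evaluation on a pushed-forward directed `L`-subset into
evaluation of the preimage. -/
theorem zadeh_iSup_inf (f : P → Q) (D : P → L) (B : Q → L) :
    ⨆ y, B y ⊓ zadeh f D y = ⨆ x, B (f x) ⊓ D x := by
  simp only [zadeh, inf_iSup_eq]
  rw [iSup_comm]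
  exact iSup_congr fun x => by simp

theorem ScottCont.lCont {E : LOrder L P} {F : LOrder L Q} {f : P → Q} (hf : ScottCont E F f) :
    LCont E.scott F.scott f := by
  refine fun B hB => ⟨fun x y => ?_, fun D s hD hs => ?_⟩
  · exact (inf_le_inf_left _ (hf.mono x y)).trans (hB.1 _ _)
  · exact (hB.2 _ _ (hf.directed hD) (hf D s hD hs)).trans (zadeh_iSup_inf f D B)

end Order

/-! ### Points and `L`-weighted joins of open sets -/

section Topology

variable {L : Type u} [Order.Frame L] {X Y : Type v}

namespace LTopology

variable (T : LTopology L X)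

theorem const_inf_mem (a : L) {A : X → L} (hA : A ∈ T.opens) : (fun x => a ⊓ A x) ∈ T.opens :=
  T.inf_mem _ _ (T.const_mem a) hA

theorem mem_of_eq_iSup {ι : Type*} (a : ι → L) (B : ι → X → L) (hB : ∀ i, B i ∈ T.opens)
    {A : X → L} (h : ∀ x, A x = ⨆ i, a i ⊓ B i x) : A ∈ T.opens := by
  have : A = sSup (Set.range fun i x => a i ⊓ B i x) := by
    funext x
    rw [h x, sSup_range, iSup_apply]
  rw [this]
  exact T.sSup_mem _ (Set.range_subset_iff.2 fun i => T.const_inf_mem _ (hB i))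

variable {T}

theorem Point.map_const_inf (p : T.Point) (a : L) {A : X → L} (hA : A ∈ T.opens) :
    p.toFun ⟨fun x => a ⊓ A x, T.const_inf_mem a hA⟩ = a ⊓ p.toFun ⟨A, hA⟩ := by
  have h := p.map_inf ⟨fun _ => a, T.const_mem a⟩ ⟨A, hA⟩
  rw [p.map_const] at h
  exact h

/-- Preserving constants and binary meets makes a point `L`-linear, so it respects any expansion in
a base. -/
theorem Point.map_eq_iSup (p : T.Point) {ι : Type*} (a : ι → L) (B : ι → X → L)
    (hB : ∀ i, B i ∈ T.opens) {A : X → L} (hA : A ∈ T.opens)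
    (h : ∀ x, A x = ⨆ i, a i ⊓ B i x) :
    p.toFun ⟨A, hA⟩ = ⨆ i, a i ⊓ p.toFun ⟨B i, hB i⟩ := by
  have hS : Set.range (fun i x => a i ⊓ B i x) ⊆ T.opens :=
    Set.range_subset_iff.2 fun i => T.const_inf_mem _ (hB i)
  have hAS : A = sSup (Set.range fun i x => a i ⊓ B i x) := by
    funext x
    rw [h x, sSup_range, iSup_apply]
  have h1 : p.toFun ⟨A, hA⟩ = p.toFun ⟨_, T.sSup_mem _ hS⟩ := by
    congr 1
    exact Subtype.ext hAS
  rw [h1, p.map_sSup]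
  apply le_antisymm
  · refine iSup₂_le fun C hC => ?_
    obtain ⟨i, rfl⟩ := hC
    refine le_iSup_of_le i (le_of_eq ?_)
    exact (congrArg p.toFun (Subtype.ext rfl)).trans (p.map_const_inf (a i) (hB i))
  · refine iSup_le fun i => ?_
    rw [← p.map_const_inf (a i) (hB i)]
    exact le_iSup₂_of_le (f := fun C hC => p.toFun ⟨C, hS hC⟩) _ ⟨i, rfl⟩ le_rfl

end LTopology

/-! ### The Scott space of an algebraic `L`-dcpo -/

section ScottSpace

variable {P : Type v} {E : LOrder L P}

theorem LOrder.IsAlgebraicDcpo.isStrongLocallySuperCompact (hE : E.IsAlgebraicDcpo) :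
    E.scott.IsStrongLocallySuperCompact := by
  refine ⟨{A | ∃ c, E.IsCompactElt c ∧ A = E.e c}, ⟨?_, fun A hA => ?_⟩, ?_⟩
  · rintro _ ⟨c, hc, rfl⟩
    exact E.isScottOpen_e hc
  · refine ⟨Set.range fun c : {c // E.IsCompactElt c} => (E.e c, A c), ?_, ?_⟩
    · rintro _ ⟨c, rfl⟩
      exact ⟨c, c.2, rfl⟩
    · funext x
      rw [LOrder.IsScottOpen.eq_iSup hE hA x, iSup_range, iSup_apply]
  · rintro _ ⟨c, hc, rfl⟩
    refine ⟨top_le_iff.1 ?_, fun V hV => ?_⟩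
    · rw [← E.refl c]
      exact le_iSup (E.e c) c
    · rw [E.sub_e_eq (E.scott.sSup_mem V hV).1, sSup_apply, iSup_subtype]
      exact iSup_congr fun U => iSup_congr fun hU => (E.sub_e_eq (hV hU).1 c).symm

theorem LOrder.IsAlgebraicDcpo.point_eq (hE : E.IsAlgebraicDcpo) (p : E.scott.Point)
    {A : P → L} (hA : E.IsScottOpen A) :
    p.toFun ⟨A, hA⟩ = ⨆ c : {c // E.IsCompactElt c}, A c ⊓ p.toFun ⟨E.e c, E.isScottOpen_e c.2⟩ :=
  p.map_eq_iSup _ _ _ hA (LOrder.IsScottOpen.eq_iSup hE hA)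

/-- The directed `L`-subset of compact elements associated with a point of the Scott topology. -/
def LOrder.ofPoint (p : E.scott.Point) : P → L :=
  fun x => ⨆ hx : E.IsCompactElt x, p.toFun ⟨E.e x, E.isScottOpen_e hx⟩

theorem LOrder.IsAlgebraicDcpo.point_eq_iSup_ofPoint (hE : E.IsAlgebraicDcpo) (p : E.scott.Point)
    {A : P → L} (hA : E.IsScottOpen A) :
    p.toFun ⟨A, hA⟩ = ⨆ x, A x ⊓ LOrder.ofPoint p x := by
  rw [hE.point_eq p hA]
  simp [LOrder.ofPoint, inf_iSup_eq, iSup_subtype]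

theorem LOrder.IsAlgebraicDcpo.directed_ofPoint (hE : E.IsAlgebraicDcpo) (p : E.scott.Point) :
    E.Directed (LOrder.ofPoint p) := by
  refine ⟨?_, fun x y => ?_⟩
  · have h := hE.point_eq_iSup_ofPoint p (E.scott.const_mem ⊤)
    rw [p.map_const] at h
    simpa [IsNonempty] using h.symm
  · nth_rewrite 1 [LOrder.ofPoint]
    nth_rewrite 1 [LOrder.ofPoint]
    simp only [iSup_inf_eq, inf_iSup_eq]
    refine iSup_le fun hy => iSup_le fun hx => ?_
    -- The meet of the two values is `p` of the open set `e x ⊓ e y`; expanding that set over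
    -- compact elements supplies the upper bounds `z`.
    refine (p.map_inf ⟨_, E.isScottOpen_e hx⟩ ⟨_, E.isScottOpen_e hy⟩).ge.trans ?_
    refine (hE.point_eq_iSup_ofPoint p _).le.trans ?_
    refine iSup_mono fun z => ?_
    simp only [Pi.inf_apply]
    exact le_of_eq (by ac_rfl)

/-- Open sets determine the order, hence injectivity. For surjectivity, Scott openness says that the
value at the supremum of `ofPoint p` is the sum that computes `p`. -/
theorem LOrder.IsAlgebraicDcpo.isSober (hE : E.IsAlgebraicDcpo) : E.scott.IsSober := by
  refine ⟨fun x y h => ?_, fun p => ?_⟩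
  · have hA : ∀ A ∈ E.scott.opens, A x = A y := fun A hA =>
      congrArg (fun q : E.scott.Point => q.toFun ⟨A, hA⟩) h
    apply E.antisymm
    rw [← E.iInf_scott_himp hE, ← E.iInf_scott_himp hE, inf_eq_top_iff]
    constructor <;> simp +contextual [hA]
  · obtain ⟨s, hs⟩ := hE.1 _ (hE.directed_ofPoint p)
    refine ⟨s, ?_⟩
    ext A
    exact (A.2.2 _ s (hE.directed_ofPoint p) hs).trans (hE.point_eq_iSup_ofPoint p A.2).symm

theorem LOrder.IsAlgebraicDcpo.specialization_scott (hE : E.IsAlgebraicDcpo)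
    (h : E.scott.IsT0) : E.scott.specialization h = E :=
  LOrder.ext fun x y => E.iInf_scott_himp hE x y

end ScottSpace

/-! ### The specialization order of a sober space -/

section SoberSpace

namespace LTopology

variable {T : LTopology L X} {U : LTopology L Y}

theorem specialization_isUpper (h : T.IsT0) {A : X → L} (hA : A ∈ T.opens) :
    (T.specialization h).IsUpper A := by
  intro x y
  rw [inf_comm]
  exact le_himp_iff.1 (iInf₂_le A hA)

/-- An element at which every open set takes the expected value is a supremum. -/
theorem isSup_specialization (h : T.IsT0) {D : X → L} {s : X}
    (hs : ∀ A ∈ T.opens, A s = ⨆ x, A x ⊓ D x) : (T.specialization h).IsSup D s := by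
  intro y
  change ⨅ A ∈ T.opens, A s ⇨ A y = ⨅ x, D x ⇨ ⨅ A ∈ T.opens, A x ⇨ A y
  simp only [himp_iInf_eq]
  rw [iInf_comm]
  refine iInf_congr fun A => ?_
  rw [iInf_comm]
  refine iInf_congr fun hA => ?_
  rw [hs A hA, iSup_himp_eq]
  refine iInf_congr fun x => ?_
  rw [himp_himp, inf_comm]

/-- The point of the open sets given by a directed `L`-subset. -/
def pointOfDirected (h : T.IsT0) (D : X → L) (hD : (T.specialization h).Directed D) :
    T.Point where
  toFun A := ⨆ x, A.1 x ⊓ D x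
  map_inf A B := by
    apply le_antisymm
    · exact le_inf (iSup_mono fun x => inf_le_inf_right _ inf_le_left)
        (iSup_mono fun x => inf_le_inf_right _ inf_le_right)
    · rw [iSup_inf_iSup]
      refine iSup_le fun ⟨x, y⟩ => ?_
      rw [inf_inf_inf_comm]
      refine (inf_le_inf_left _ (hD.2 x y)).trans ?_
      rw [inf_iSup_eq]
      refine iSup_le fun z => le_iSup_of_le z (le_inf (le_inf ?_ ?_) ?_)
      · refine le_trans (le_inf ?_ ?_) (specialization_isUpper h A.2 x z)
        · exact inf_le_left.trans inf_le_left
        · exact inf_le_right.trans (inf_le_left.trans inf_le_right)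
      · refine le_trans (le_inf ?_ ?_) (specialization_isUpper h B.2 y z)
        · exact inf_le_left.trans inf_le_right
        · exact inf_le_right.trans inf_le_right
      · exact inf_le_right.trans (inf_le_left.trans inf_le_left)
  map_sSup S hS := by
    simp only [sSup_apply, iSup_inf_eq, iSup_subtype]
    rw [iSup_comm]
    exact iSup_congr fun A => iSup_comm
  map_const a := by
    have h : ⨆ x, D x = ⊤ := hD.1
    rw [← inf_iSup_eq, h, inf_top_eq]

theorem IsSober.exists_eq (hT : T.IsSober) (p : T.Point) :
    ∃ s, ∀ (A : X → L) (hA : A ∈ T.opens), A s = p.toFun ⟨A, hA⟩ := by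
  obtain ⟨s, rfl⟩ := hT.2 p
  exact ⟨s, fun _ _ => rfl⟩

theorem IsSober.exists_isSup (hT : T.IsSober) {D : X → L}
    (hD : (T.specialization hT.isT0).Directed D) :
    ∃ s, (T.specialization hT.isT0).IsSup D s ∧ ∀ A ∈ T.opens, A s = ⨆ x, A x ⊓ D x := by
  obtain ⟨s, hs⟩ := hT.exists_eq (pointOfDirected hT.isT0 D hD)
  exact ⟨s, isSup_specialization hT.isT0 hs, hs⟩

theorem IsSober.isScottOpen (hT : T.IsSober) {A : X → L} (hA : A ∈ T.opens) :
    (T.specialization hT.isT0).IsScottOpen A := by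
  refine ⟨specialization_isUpper _ hA, fun D s hD hs => ?_⟩
  obtain ⟨t, ht, h⟩ := hT.exists_isSup hD
  rw [hs.unique ht]
  exact h A hA

theorem scottCont_of_lCont (hT : T.IsSober) (hU : U.IsT0) {f : X → Y} (hf : LCont T U f) :
    ScottCont (T.specialization hT.isT0) (U.specialization hU) f := by
  intro D s hD hs
  refine isSup_specialization hU fun B hB => ?_
  rw [zadeh_iSup_inf]
  exact (hT.isScottOpen (hf B hB)).2 D s hD hs

/-- The point `V ↦ sub(A, V)` given by a super-compact `L`-subset `A`. -/
def IsSuperCompact.point {A : X → L} (hA : T.IsSuperCompact A) : T.Point where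
  toFun V := sub A V.1
  map_inf V W := by simp [sub, himp_inf_distrib, iInf_inf_eq]
  map_sSup S hS := hA.2 S hS
  map_const a := by
    have h : ⨆ x, A x = ⊤ := hA.1
    rw [sub, ← iSup_himp_eq, h, top_himp]

/-- In a sober space, a super-compact open set is a principal upper set. -/
theorem IsSober.exists_eq_e (hT : T.IsSober) {A : X → L} (hA : A ∈ T.opens)
    (hc : T.IsSuperCompact A) : ∃ c, A = (T.specialization hT.isT0).e c := by
  obtain ⟨c, h⟩ := hT.exists_eq hc.point
  -- Here `V c = sub A V` for all open `V`. So `A y ⊓ V c ≤ V y`, which gives `A y ≤ e c y`; and `V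
  -- = A` gives `A c = ⊤`, hence the converse.
  refine ⟨c, funext fun y => le_antisymm (le_iInf₂ fun V hV => ?_) ?_⟩
  · rw [h V hV, le_himp_iff, inf_comm]
    exact le_himp_iff.1 (iInf_le _ y)
  · refine (iInf₂_le A hA).trans ?_
    rw [h A hA]
    simp [IsSuperCompact.point, sub]

/-- The elements whose principal upper set is open. -/
def openPrincipal (h : T.IsT0) : Set X := {c | (T.specialization h).e c ∈ T.opens}

theorem IsSober.eq_iSup_openPrincipal (hT : T.IsSober) (hS : T.IsStrongLocallySuperCompact)
    {A : X → L} (hA : A ∈ T.opens) (x : X) :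
    A x = ⨆ y, A y ⊓ (T.specialization hT.isT0).downIn (openPrincipal hT.isT0) x y := by
  simp only [LOrder.downIn, inf_iSup_eq]
  apply le_antisymm
  · obtain ⟨B, ⟨hBo, hB⟩, hBc⟩ := hS
    obtain ⟨J, hJ, hAJ⟩ := hB A hA
    have hAx : ∀ y, A y = ⨆ j ∈ J, j.2 ⊓ j.1 y := fun y => by
      conv_lhs => rw [hAJ]
      simp only [iSup_apply]
    rw [hAx x]
    refine iSup₂_le fun j hj => ?_
    obtain ⟨c, hc⟩ := hT.exists_eq_e (hBo (hJ j hj)) (hBc _ (hJ j hj))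
    refine le_iSup₂_of_le c (show _ ∈ T.opens from hc ▸ hBo (hJ j hj)) ?_
    rw [← hc]
    -- The coefficient `j.2` is at most `A c`: the `j`-th term of the expansion at `c` is `j.2 ⊓ e c
    -- c`.
    refine inf_le_inf_right _ ?_
    rw [hAx c]
    refine le_iSup₂_of_le j hj ?_
    rw [hc, LOrder.refl, inf_top_eq]
  · exact iSup₂_le fun y _ => specialization_isUpper _ hA y x

/-- The expansion over open principal upper sets, applied to the constant `⊤`, gives nonemptiness;
applied to `e y ⊓ e z` at `x`, it gives directedness. -/
theorem IsSober.directed_downIn (hT : T.IsSober) (hS : T.IsStrongLocallySuperCompact) (x : X) :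
    (T.specialization hT.isT0).Directed
      ((T.specialization hT.isT0).downIn (openPrincipal hT.isT0) x) := by
  refine ⟨?_, fun y z => ?_⟩
  · have h := hT.eq_iSup_openPrincipal hS (T.const_mem ⊤) x
    simpa [IsNonempty] using h.symm
  · nth_rewrite 1 [LOrder.downIn]
    nth_rewrite 1 [LOrder.downIn]
    simp only [iSup_inf_eq, inf_iSup_eq]
    refine iSup_le fun hz => iSup_le fun hy => ?_
    refine (hT.eq_iSup_openPrincipal hS (T.inf_mem _ _ hy hz) x).le.trans ?_
    refine iSup_mono fun w => ?_
    simp only [Pi.inf_apply]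
    exact le_of_eq (by ac_rfl)

theorem IsSober.isSup_downIn (hT : T.IsSober) (hS : T.IsStrongLocallySuperCompact) (x : X) :
    (T.specialization hT.isT0).IsSup
      ((T.specialization hT.isT0).downIn (openPrincipal hT.isT0) x) x :=
  isSup_specialization _ fun _ hA => hT.eq_iSup_openPrincipal hS hA x

/-- A Scott open set of the specialization order of a strong locally super-compact sober space is
open. -/
theorem IsSober.mem_opens (hT : T.IsSober) (hS : T.IsStrongLocallySuperCompact) {A : X → L}
    (hA : (T.specialization hT.isT0).IsScottOpen A) : A ∈ T.opens := by
  refine T.mem_of_eq_iSup (fun c : openPrincipal hT.isT0 => A c)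
    (fun c => (T.specialization hT.isT0).e c) (fun c => c.2) fun x => ?_
  rw [hA.2 _ x (hT.directed_downIn hS x) (hT.isSup_downIn hS x)]
  simp only [LOrder.downIn, inf_iSup_eq, iSup_subtype]

theorem IsSober.scott_specialization (hT : T.IsSober) (hS : T.IsStrongLocallySuperCompact) :
    (T.specialization hT.isT0).scott = T :=
  LTopology.ext fun _ => ⟨fun hA => hT.mem_opens hS hA, fun hA => hT.isScottOpen hA⟩

theorem IsSober.isAlgebraicDcpo (hT : T.IsSober) (hS : T.IsStrongLocallySuperCompact) :
    (T.specialization hT.isT0).IsAlgebraicDcpo := by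
  -- Both conditions say that `e c` is open, since the Scott topology is the original one.
  have hK : {c | (T.specialization hT.isT0).IsCompactElt c} = openPrincipal hT.isT0 :=
    Set.ext fun c => ⟨fun hc => hT.mem_opens hS (LOrder.isScottOpen_e _ hc),
      fun hc => LOrder.isCompactElt_of_isScottOpen _ (hT.isScottOpen hc)⟩
  refine ⟨fun D hD => ?_, fun x => ?_⟩
  · obtain ⟨s, hs, -⟩ := hT.exists_isSup hD
    exact ⟨s, hs⟩
  · rw [LOrder.k_eq_downIn, hK]
    exact ⟨hT.directed_downIn hS x, hT.isSup_downIn hS x⟩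

end LTopology

end SoberSpace

end Topology

/-! ### The two functors and their composites -/

section Functors

variable (L : Type u) [Order.Frame L]

/-- The functor `Σ_L` from the algebraic `L`-dcpos to strong locally super-compact sober spaces. -/
def scottFunctor : AlgDom.{u, v} L ⥤ SLSCSob.{u, v} L where
  obj P := ⟨P.obj.scottSpace, P.property.isStrongLocallySuperCompact, P.property.isSober⟩
  map f := ObjectProperty.homMk ⟨f.hom.toFun, f.hom.cont.lCont⟩

/-- The functor `Ω_L` from strong locally super-compact sober spaces to algebraic `L`-dcpos. -/
def specFunctor : SLSCSob.{u, v} L ⥤ AlgDom.{u, v} L where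
  obj X := ⟨X.obj.specSet X.property.2.isT0, X.property.2.isAlgebraicDcpo X.property.1⟩
  map {X Y} f := ObjectProperty.homMk
    ⟨f.hom.toFun, LTopology.scottCont_of_lCont X.property.2 Y.property.2.isT0 f.hom.cont⟩

instance : (LPos.forget.{u, v} L).Faithful where
  map_injective h :=
    LPos.Hom.ext (funext fun x => ConcreteCategory.congr_hom h x)

instance : (LTop.forget.{u, v} L).Faithful where
  map_injective h :=
    LTop.Hom.ext (funext fun x => ConcreteCategory.congr_hom h x)

end Functors

/-- Functors that agree on objects and after composition with a faithful functor are equal. -/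
theorem functor_eq_of_comp_faithful {C D E : Type*} [Category C] [Category D] [Category E]
    {F G : C ⥤ D} (U : D ⥤ E) [U.Faithful] (h : ∀ X, F.obj X = G.obj X)
    (hU : F ⋙ U = G ⋙ U) : F = G := by
  refine CategoryTheory.Functor.ext h fun X Y f => U.map_injective ?_
  simpa [eqToHom_map] using CategoryTheory.Functor.congr_hom hU f

end FrameDomain

theorem mainTheorem2 (L : Type u) [Order.Frame L] :
    ∃ (S : FrameDomain.AlgDom.{u, v} L ⥤ FrameDomain.SLSCSob.{u, v} L)
      (W : FrameDomain.SLSCSob.{u, v} L ⥤ FrameDomain.AlgDom.{u, v} L),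
      -- on objects the functors are `P ↦ Σ_L P` and `X ↦ Ω_L X`
      (∀ P, (S.obj P).obj = P.obj.scottSpace) ∧
      (∀ X, (W.obj X).obj = X.obj.specSet X.property.2.isT0) ∧
      -- on morphisms they do not change the underlying map
      S ⋙ (FrameDomain.isSLSCSob L).ι ⋙ FrameDomain.LTop.forget L =
        (FrameDomain.isAlgDom L).ι ⋙ FrameDomain.LPos.forget L ∧
      W ⋙ (FrameDomain.isAlgDom L).ι ⋙ FrameDomain.LPos.forget L =
        (FrameDomain.isSLSCSob L).ι ⋙ FrameDomain.LTop.forget L ∧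
      -- they are mutually inverse
      S ⋙ W = 𝟭 _ ∧ W ⋙ S = 𝟭 _ := by
  refine ⟨FrameDomain.scottFunctor L, FrameDomain.specFunctor L, fun _ => rfl, fun _ => rfl,
    rfl, rfl, ?_, ?_⟩
  -- Underlying sets and maps are untouched, so over sets the functors agree by `rfl`; only the
  -- equality of structures on each object remains.
  · refine FrameDomain.functor_eq_of_comp_faithful
      ((FrameDomain.isAlgDom L).ι ⋙ FrameDomain.LPos.forget L) (fun P => ?_) rfl
    obtain ⟨⟨P, E⟩, hE⟩ := P
    have h := FrameDomain.LOrder.IsAlgebraicDcpo.specialization_scott hE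
      (FrameDomain.LOrder.IsAlgebraicDcpo.isSober hE).isT0
    exact ObjectProperty.FullSubcategory.ext (congrArg (FrameDomain.LPos.mk P) h)
  · refine FrameDomain.functor_eq_of_comp_faithful
      ((FrameDomain.isSLSCSob L).ι ⋙ FrameDomain.LTop.forget L) (fun X => ?_) rfl
    obtain ⟨⟨X, T⟩, hT⟩ := X
    exact ObjectProperty.FullSubcategory.ext
      (congrArg (FrameDomain.LTop.mk X) (hT.2.scott_specialization hT.1))
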